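/- Let $T$ be a $\sigma$-compact locally compact Hausdorff space with its Borel $\sigma$-algebra, let $C$ be the Banach space of continuous functions $y:T\to\mathbb R^d$ that vanish at infinity, and let $M$ be the space of $\mathbb R^d$-valued regular Borel measures $\theta$ on $T$ with finite total variation $|\theta|$, paired with $C$ by $\langle y,\theta\rangle=\int y\,d\theta$. Let $S$ be a mapping that assigns to each $t\in T$ a convex set $S_t\subseteq\mathbb R^d$, and assume that the set of continuous selections $C(S)=\{y\in C: y_t\in S_t\ \forall t\in T\}$ is non-empty. Write $$\sigma_{C(S)}(\theta)=\sup_{y\in C(S)}\langle y,\theta\rangle,\qquad \sigma_{S_t}(x)=\sup_{v\in S_t}x\cdot v,$$ and, for a set $A$, let $N_A(y)$ be the set of normals to $A$ at $y$: if $y\in A$, it consists of all $\theta$ with $\langle y'-y,\theta\rangle\le 0$ for every $y'\in A$, and it is empty if $y\notin A$. Here $A\subseteq C$ and $\theta\in M$, or $A\subseteq\mathbb R^d$ and the pairing is the scalar product. The mapping $S$ is inner semicontinuous if for all $t\in T$, $x\in S_t$ and every open $A\ni x$, the set $\{s\in T: S_s\cap A\neq\emptyset\}$ is a neighbourhood of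 $t$. For $f:T\to[-\infty,\infty]$ put $\int f\,d|\theta|=\int f^+\,d|\theta|-\int f^-\,d|\theta|$ (should $f$ fail to be measurable, the two integrals on the right are lower integrals, that is, suprema of the integrals of the measurable functions below $f^\pm$). Consider the representation $$\sigma_{C(S)}(\theta)=\int \sigma_{S_t}\Big(\frac{d\theta}{d|\theta|}(t)\Big)\,d|\theta|(t)\qquad\text{for all }\theta\in M.\tag{R}$$ 1. If (R) holds, then $S$ is inner semicontinuous. 2. If $T$ is perfectly normal or every $S_t$ is closed, then (R) holds if and only if $S$ is inner semicontinuous. 3. If $S$ is inner semicontinuous, then for every $\theta\in M$ the integrand in (R) is $|\theta|$-measurable and its negative part is $|\theta|$-integrable. 4. If (R) holds, then for all $\theta\in M$ and $y\in C(S)$: $\theta\in N_{C(S)}(y)$ if and only if $\frac{d\theta}{d|\theta|}(t)\in N_{S_t}(y_t)$ for $|\theta|$-almost every $t$. -/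

import Mathlib

open MeasureTheory Topology

noncomputable section

/-! ### Support functions and normals with respect to a pairing -/

/-- The support function `σ_A(θ) = sup_{y ∈ A} ⟨y, θ⟩` of a set `A ⊆ X`, with respect to a pairing
`B : X → Y → ℝ`, as an extended real number. -/
def supportFun {X Y : Type*} (B : X → Y → ℝ) (A : Set X) (θ : Y) : EReal :=
  ⨆ y ∈ A, (B y θ : EReal)

/-- The set `N_A(y)` of normals to `A` at `y`, with respect to a pairing `B : X → Y → ℝ`. It is empty
if `y ∉ A`. -/
def normals {X Y : Type*} [Sub X] (B : X → Y → ℝ) (A : Set X) (y : X) : Set Y :=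
  {θ | y ∈ A ∧ ∀ y' ∈ A, B (y' - y) θ ≤ 0}

/-- The scalar product of `ℝ^d`. -/
def dot {d : ℕ} (v x : EuclideanSpace ℝ (Fin d)) : ℝ := inner ℝ v x

/-! ### Set-valued mappings -/

/-- The inner limit `liminf S_t` of a set-valued mapping at `t`: the points `x` such that the preimage
of every open neighbourhood of `x` is a neighbourhood of `t`. -/
def innerLimit {T E : Type*} [TopologicalSpace T] [TopologicalSpace E] (S : T → Set E) (t : T) :
    Set E :=
  {x | ∀ A : Set E, IsOpen A → x ∈ A → {s | (S s ∩ A).Nonempty} ∈ 𝓝 t}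

/-- Inner semicontinuity of a set-valued mapping. -/
def InnerSemicontinuous {T E : Type*} [TopologicalSpace T] [TopologicalSpace E] (S : T → Set E) :
    Prop :=
  ∀ t, S t ⊆ innerLimit S t

/-- Inner semicontinuity is Mathlib's lower hemicontinuity. -/
theorem innerSemicontinuous_iff_lowerHemicontinuous {T E : Type*} [TopologicalSpace T]
    [TopologicalSpace E] (S : T → Set E) : InnerSemicontinuous S ↔ LowerHemicontinuous S := by
  constructor
  · intro h t
    rw [← LowerHemicontinuousAt, lowerHemicontinuousAt_iff]
    rintro u hu ⟨x, hx, hxu⟩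
    exact h t hx u hu hxu
  · intro h t x hx A hA hxA
    exact (lowerHemicontinuousAt_iff.mp (h t)) A hA ⟨x, hx, hxA⟩

/-- The set `C(S)` of the continuous selections of `S` that vanish at infinity. -/
def continuousSelections {T : Type*} [TopologicalSpace T] {d : ℕ}
    (S : T → Set (EuclideanSpace ℝ (Fin d))) :
    Set (ZeroAtInftyContinuousMap T (EuclideanSpace ℝ (Fin d))) :=
  {y | ∀ t, y t ∈ S t}

/-! ### Vector measures -/

/-- The space `M` of `ℝ^d`-valued regular Borel measures of finite total variation. -/
def regularVectorMeasures (T : Type*) [TopologicalSpace T] [MeasurableSpace T] (d : ℕ) :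
    Set (VectorMeasure T (EuclideanSpace ℝ (Fin d))) :=
  {θ | IsFiniteMeasure θ.variation ∧ θ.variation.Regular}

/-- The `i`-th component of an `ℝ^d`-valued measure. -/
def component {T : Type*} [MeasurableSpace T] {d : ℕ}
    (θ : VectorMeasure T (EuclideanSpace ℝ (Fin d))) (i : Fin d) : SignedMeasure T :=
  θ.mapRange (EuclideanSpace.proj (𝕜 := ℝ) i).toLinearMap.toAddMonoidHom
    (EuclideanSpace.proj (𝕜 := ℝ) i).continuous

theorem component_apply {T : Type*} [MeasurableSpace T] {d : ℕ}
    (θ : VectorMeasure T (EuclideanSpace ℝ (Fin d))) (i : Fin d) (s : Set T) :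
    component θ i s = θ s i :=
  rfl

/-- The density `dθ/d|θ|` of `θ` with respect to its total variation: the vector of the
Radon-Nikodym derivatives of the components of `θ`. -/
def polarDensity {T : Type*} [MeasurableSpace T] {d : ℕ}
    (θ : VectorMeasure T (EuclideanSpace ℝ (Fin d))) (t : T) : EuclideanSpace ℝ (Fin d) :=
  WithLp.toLp 2 fun i => (component θ i).rnDeriv θ.variation t

/-- The pairing `⟨y, θ⟩ = ∫ y dθ` between `C₀(T; ℝ^d)` and the `ℝ^d`-valued measures on `T`. -/
def pairing {T : Type*} [TopologicalSpace T] [MeasurableSpace T] {d : ℕ}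
    (y : ZeroAtInftyContinuousMap T (EuclideanSpace ℝ (Fin d)))
    (θ : VectorMeasure T (EuclideanSpace ℝ (Fin d))) : ℝ :=
  θ.integral y (innerSL ℝ)

/-- The integral `∫ f⁺ dμ - ∫ f⁻ dμ` of an extended real-valued function. -/
def erealIntegral {T : Type*} [MeasurableSpace T] (μ : Measure T) (f : T → EReal) : EReal :=
  ((∫⁻ t, (f t).toENNReal ∂μ : ENNReal) : EReal) - ((∫⁻ t, (-f t).toENNReal ∂μ : ENNReal) : EReal)

/-- The function `t ↦ σ_{S_t}((dθ/d|θ|)_t)`. -/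
def supportIntegrand {T : Type*} [MeasurableSpace T] {d : ℕ}
    (S : T → Set (EuclideanSpace ℝ (Fin d)))
    (θ : VectorMeasure T (EuclideanSpace ℝ (Fin d))) (t : T) : EReal :=
  supportFun dot (S t) (polarDensity θ t)

/-- The integral representation `σ_{C(S)}(θ) = ∫ σ_S(dθ/d|θ|) d|θ|` holds for every `θ ∈ M`. -/
def HasIntegralRepresentation {T : Type*} [TopologicalSpace T] [MeasurableSpace T] {d : ℕ}
    (S : T → Set (EuclideanSpace ℝ (Fin d))) : Prop :=
  ∀ θ ∈ regularVectorMeasures T d,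
    supportFun pairing (continuousSelections S) θ =
      erealIntegral θ.variation (supportIntegrand S θ)

end

/-! ### Inner semicontinuity and Michael's selection theorem -/

section Selections

open Metric Set Filter

variable {T E : Type*} [TopologicalSpace T] [NormedAddCommGroup E]

/-! Write p = dθ/d|θ|. By `pairing_eq_integral`, ⟨y,θ⟩ = ∫ y·p d|θ|, so "≤" in (R) is monotonicity,
because y·p ≤ σ_S(p) for every selection y.

For "≥", fix a selection y₀ and a simple function φ below the nonnegative gap σ_S(p) − y₀·p. By
Lusin's theorem, p and φ are continuous on a compact K carrying almost all the mass. If the values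
of the continuous selections are dense in each S_t, then some selection beats y₀·p + φ − η near each
point of K. This condition is convex, so a partition of unity produces one selection that beats it
on all of K. Cutting back to y₀ outside a tight neighbourhood of K costs arbitrarily little.

The density comes from Michael's theorem when the values are closed. On a perfectly normal T, it is
applied to the closures, and a selection of these is mixed with a little of a mean w of a dense
sequence of selections. Since w_t is a strictly positive mean, the mixture lies in S_t itself
(`Convex.combo_hasSum_mem`).

Conversely, (R) at the measures vδ_t and Hahn-Banach show that the selections have dense values in
S_t; their continuity gives inner semicontinuity. Measurability follows from lower semicontinuity of
(t,x) ↦ σ_{S_t}(x), and the normality criterion from the fact that a nonnegative gap has zero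
integral iff it vanishes almost everywhere. -/

protected theorem InnerSemicontinuous.closure {S : T → Set E} (hS : InnerSemicontinuous S) :
    InnerSemicontinuous fun t => closure (S t) := by
  intro t x hx A hA hxA
  obtain ⟨z, hzA, hz⟩ := mem_closure_iff.1 hx A hA hxA
  filter_upwards [hS t hz A hA hzA] with s hs
  exact hs.mono (inter_subset_inter_left _ subset_closure)

theorem InnerSemicontinuous.isOpen_inter_nonempty {S : T → Set E} (hS : InnerSemicontinuous S)
    {A : Set E} (hA : IsOpen A) : IsOpen {t | (S t ∩ A).Nonempty} :=
  isOpen_iff_mem_nhds.2 fun _ ⟨_, hx, hxA⟩ => hS _ hx A hA hxA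

/-- The ball is open, so a point in it leaves room both for the centre `g` to move and for the point
to be replaced by a nearby one. -/
theorem InnerSemicontinuous.inter_ball {S : T → Set E} (hS : InnerSemicontinuous S)
    {g : T → E} (hg : Continuous g) (r : ℝ) :
    InnerSemicontinuous fun t => S t ∩ ball (g t) r := by
  intro t x ⟨hx, hxr⟩ A hA hxA
  obtain ⟨δ, hδ, hδr⟩ : ∃ δ > 0, dist x (g t) + δ < r :=
    ⟨(r - dist x (g t)) / 2, by simp only [mem_ball] at hxr; linarith,
      by simp only [mem_ball] at hxr; linarith⟩
  have h₁ := hS t hx (A ∩ ball x (δ / 2)) (hA.inter isOpen_ball) ⟨hxA, mem_ball_self (by linarith)⟩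
  have h₂ := Metric.tendsto_nhds.1 (hg.continuousAt (x := t)) (δ / 2) (by linarith)
  filter_upwards [h₁, h₂] with s ⟨z, hzS, hzA, hzx⟩ hs
  refine ⟨z, ⟨hzS, ?_⟩, hzA⟩
  have h₃ := dist_triangle4 z x (g t) (g s)
  rw [dist_comm (g t)] at h₃
  simp only [mem_ball] at *
  linarith

/-- Shrinking the values of an inner semicontinuous mapping over a closed set to those of another
inner semicontinuous mapping preserves inner semicontinuity. -/
theorem InnerSemicontinuous.ite {S R : T → Set E} (hS : InnerSemicontinuous S)
    (hR : InnerSemicontinuous R) (hRS : ∀ t, R t ⊆ S t) {F : Set T} (hF : IsClosed F)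
    [∀ t, Decidable (t ∈ F)] :
    InnerSemicontinuous fun t => if t ∈ F then R t else S t := by
  intro t x hx A hA hxA
  by_cases ht : t ∈ F
  · simp only [if_pos ht] at hx
    filter_upwards [hR t hx A hA hxA] with s hs
    refine hs.mono (inter_subset_inter_left _ ?_)
    split_ifs
    exacts [subset_rfl, hRS s]
  · simp only [if_neg ht] at hx
    filter_upwards [hS t hx A hA hxA, hF.isOpen_compl.mem_nhds ht] with s hs hsF
    rwa [if_neg hsF]

variable [NormedSpace ℝ E]

section Michael

variable [NormalSpace T] [ParacompactSpace T]

/-- By inner semicontinuity a point of `S t` stays in the `ε`-thickening of nearby values, so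
constants are local selections of the convex-valued thickening and a partition of unity glues them.
-/
theorem InnerSemicontinuous.exists_continuous_approx {S : T → Set E} (hS : InnerSemicontinuous S)
    (hconv : ∀ t, Convex ℝ (S t)) (hne : ∀ t, (S t).Nonempty) {ε : ℝ} (hε : 0 < ε) :
    ∃ g : C(T, E), ∀ t, (S t ∩ ball (g t) ε).Nonempty := by
  obtain ⟨g, hg⟩ := exists_continuous_forall_mem_convex_of_local_const
    (t := fun t => thickening ε (S t)) (fun t => (hconv t).thickening ε) (fun t => by
      obtain ⟨x, hx⟩ := hne t
      refine ⟨x, ?_⟩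
      filter_upwards [hS t hx (ball x ε) isOpen_ball (mem_ball_self hε)] with s ⟨z, hz, hzx⟩
      exact mem_thickening_iff.2 ⟨z, hz, by rwa [dist_comm]⟩)
  refine ⟨g, fun t => ?_⟩
  obtain ⟨z, hz, hzx⟩ := mem_thickening_iff.1 (hg t)
  exact ⟨z, hz, by rwa [mem_ball, dist_comm]⟩

/-- Approximating `S t ∩ ball (g t) r` instead of `S t` keeps the new function close to the old one;
this makes the iteration in Michael's theorem uniformly Cauchy. -/
theorem InnerSemicontinuous.exists_continuous_refine {S : T → Set E} (hS : InnerSemicontinuous S)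
    (hconv : ∀ t, Convex ℝ (S t)) {r : ℝ} (hr : 0 < r) (g : C(T, E))
    (hg : ∀ t, (S t ∩ ball (g t) r).Nonempty) :
    ∃ g' : C(T, E), (∀ t, (S t ∩ ball (g' t) (r / 2)).Nonempty) ∧
      ∀ t, dist (g t) (g' t) ≤ 2 * r := by
  obtain ⟨g', hg'⟩ := (hS.inter_ball g.continuous r).exists_continuous_approx
    (fun t => (hconv t).inter (convex_ball _ _)) hg (half_pos hr)
  refine ⟨g', fun t => (hg' t).mono (inter_subset_inter_left _ inter_subset_left), fun t => ?_⟩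
  obtain ⟨z, ⟨-, hz⟩, hz'⟩ := hg' t
  have := dist_triangle_left (g t) (g' t) z
  simp only [mem_ball] at hz hz'
  linarith

/-- Michael's selection theorem. -/
theorem InnerSemicontinuous.exists_continuous_selection [CompleteSpace E] {S : T → Set E}
    (hS : InnerSemicontinuous S) (hconv : ∀ t, Convex ℝ (S t)) (hne : ∀ t, (S t).Nonempty)
    (hclosed : ∀ t, IsClosed (S t)) : ∃ g : C(T, E), ∀ t, g t ∈ S t := by
  have hpos : ∀ n : ℕ, (0 : ℝ) < 1 / 2 ^ n := fun n => by positivity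
  have step : ∀ (n : ℕ) (g : C(T, E)), (∀ t, (S t ∩ ball (g t) (1 / 2 ^ n)).Nonempty) →
      ∃ g' : C(T, E), (∀ t, (S t ∩ ball (g' t) (1 / 2 ^ (n + 1))).Nonempty) ∧
        ∀ t, dist (g t) (g' t) ≤ 2 * (1 / 2 ^ n) := fun n g hg => by
    obtain ⟨g', h₁, h₂⟩ := hS.exists_continuous_refine hconv (hpos n) g hg
    exact ⟨g', by simpa only [div_div, ← pow_succ] using h₁, h₂⟩
  choose! F hF hFdist using step
  obtain ⟨g₀, hg₀⟩ := hS.exists_continuous_approx hconv hne one_pos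
  let G : ℕ → C(T, E) := fun n => Nat.rec g₀ F n
  have hG : ∀ n t, (S t ∩ ball (G n t) (1 / 2 ^ n)).Nonempty := by
    intro n
    induction n with
    | zero => simpa [G] using hg₀
    | succ n ih => exact hF n (G n) ih
  have hGd : ∀ t n, dist (G n t) (G (n + 1) t) ≤ 4 / 2 / 2 ^ n := fun t n => by
    refine (hFdist n (G n) (hG n) t).trans (le_of_eq (by ring))
  choose g hg using fun t => cauchySeq_tendsto_of_complete (cauchySeq_of_le_geometric_two (hGd t))
  have hunif : TendstoUniformly (fun n t => G n t) g atTop := by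
    rw [Metric.tendstoUniformly_iff]
    intro ε hε
    have : Tendsto (fun n : ℕ => (4 : ℝ) / 2 ^ n) atTop (𝓝 0) := by
      simpa [div_eq_mul_inv] using
        (tendsto_pow_atTop_nhds_zero_of_lt_one (r := (1 / 2 : ℝ)) (by norm_num)
          (by norm_num)).const_mul 4
    filter_upwards [this.eventually (gt_mem_nhds hε)] with n hn t
    rw [dist_comm]
    exact (dist_le_of_le_geometric_two_of_tendsto (hGd t) (hg t) n).trans_lt hn
  refine ⟨⟨g, hunif.continuous (Frequently.of_forall fun n => (G n).continuous)⟩, fun t => ?_⟩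
  -- The points `z n` of `S t` lie within `1 / 2 ^ n` of `G n t`, so they share its limit, which
  -- closedness keeps in `S t`.
  choose z hz using fun n => hG n t
  refine (hclosed t).mem_of_tendsto (f := z) (b := atTop) ?_ (Eventually.of_forall fun n => (hz n).1)
  refine (tendsto_iff_of_dist ?_).1 (hg t)
  refine squeeze_zero (fun _ => dist_nonneg) (fun n => ?_)
    (tendsto_pow_atTop_nhds_zero_of_lt_one (r := (1 / 2 : ℝ)) (by norm_num) (by norm_num))
  rw [one_div_pow, dist_comm]
  exact (mem_ball.1 (hz n).2).le

open Classical in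
-- Replacing the single value at `t₀` by `{x}` preserves inner semicontinuity: near `t₀` this is the
-- condition on `S` at `x`, and elsewhere `t₀` can be avoided because points are closed.
theorem InnerSemicontinuous.exists_continuous_selection_through [T1Space T] [CompleteSpace E]
    {S : T → Set E} (hS : InnerSemicontinuous S) (hconv : ∀ t, Convex ℝ (S t))
    (hne : ∀ t, (S t).Nonempty) (hclosed : ∀ t, IsClosed (S t)) {t₀ : T} {x : E}
    (hx : x ∈ S t₀) : ∃ g : C(T, E), (∀ t, g t ∈ S t) ∧ g t₀ = x := by
  have hI : InnerSemicontinuous fun t => if t ∈ ({t₀} : Set T) then {x} else S t := by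
    intro t z hz A hA hzA
    by_cases ht : t = t₀
    · subst ht
      obtain rfl : z = x := by simpa using hz
      filter_upwards [hS t hx A hA hzA] with s hs
      by_cases hst : s = t
      · exact ⟨z, by simp [hst], hzA⟩
      · simpa [hst] using hs
    · replace hz : z ∈ S t := by simpa [ht] using hz
      filter_upwards [hS t hz A hA hzA, isOpen_ne.mem_nhds ht] with s hs hst
      rwa [if_neg (by simpa using hst)]
  obtain ⟨g, hg⟩ := hI.exists_continuous_selection
    (fun t => by split_ifs; exacts [convex_singleton _, hconv t])
    (fun t => by split_ifs; exacts [singleton_nonempty _, hne t])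
    (fun t => by split_ifs; exacts [isClosed_singleton, hclosed t])
  refine ⟨g, fun t => ?_, by simpa using hg t₀⟩
  have := hg t
  split_ifs at this with h
  · obtain rfl : t = t₀ := h
    rwa [mem_singleton_iff.1 this]
  · exact this

end Michael

end Selections

/-! ### Convex sets, their closures and strictly positive means -/

section RelativeInterior

open Metric Set Filter

variable {E : Type*} [NormedAddCommGroup E] [NormedSpace ℝ E]

/-- Proper separation of a convex set in a finite-dimensional space from a point of its closure. -/
theorem Convex.exists_proper_separation [FiniteDimensional ℝ E] {S : Set E} (hS : Convex ℝ S)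
    {y : E} (hy : y ∈ closure S) (hyS : y ∉ S) :
    ∃ l : StrongDual ℝ E, (∀ s ∈ S, l s ≤ l y) ∧ ∃ s ∈ S, l s < l y := by
  have hne : S.Nonempty := closure_nonempty_iff.1 ⟨y, hy⟩
  -- Translated by a relative interior point `p`, the set becomes a convex `R` in the direction
  -- space `W` with `0` in its interior, so open separation applies there; the functional is then
  -- extended to `E`.
  obtain ⟨-, p, hp, rfl⟩ := hne.intrinsicInterior hS
  set W : Submodule ℝ E := (affineSpan ℝ S).direction with hW
  let e : W → affineSpan ℝ S := fun w => ⟨(w : E) +ᵥ (p : E),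
    AffineSubspace.vadd_mem_of_mem_direction w.2 p.2⟩
  have he : Continuous e := by
    refine Continuous.subtype_mk ?_ _
    exact continuous_subtype_val.add continuous_const
  let R : Set W := {w | (w : E) + p ∈ S}
  have hR : Convex ℝ R := by
    have := (hS.translate_preimage_left (p : E)).linear_preimage W.subtype
    simpa [R, preimage] using this
  have h0 : (0 : W) ∈ interior R := by
    have h : e ⁻¹' interior ((↑) ⁻¹' S) ⊆ interior R := preimage_interior_subset_interior_preimage he
    refine h ?_
    have : e 0 = p := Subtype.ext (zero_vadd _ _)
    rwa [mem_preimage, this]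
  have hmem : ∀ s ∈ affineSpan ℝ S, s - (p : E) ∈ W := fun s hs =>
    AffineSubspace.vsub_mem_direction hs p.2
  have hyA : y ∈ affineSpan ℝ S :=
    closure_minimal (subset_affineSpan ℝ S) (AffineSubspace.closed_of_finiteDimensional _) hy
  obtain ⟨f, hf⟩ := geometric_hahn_banach_open_point (x := (⟨y - p, hmem y hyA⟩ : W))
    hR.interior isOpen_interior (fun h => hyS (by simpa [R] using interior_subset h))
  obtain ⟨l, hl, -⟩ := exists_extension_norm_eq W f
  have hle : ∀ w ∈ R, f w ≤ f ⟨y - p, hmem y hyA⟩ := by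
    intro w hw
    have hw' : w ∈ closure (interior R) := by
      rw [hR.closure_interior_eq_closure_of_nonempty_interior ⟨0, h0⟩]
      exact subset_closure hw
    exact closure_minimal (fun x hx => (hf x hx).le) (isClosed_Iic.preimage f.continuous) hw'
  have hly : l y = f ⟨y - p, hmem y hyA⟩ + l p := by rw [← hl]; simp
  refine ⟨l, fun s hs => ?_, p, interior_subset (s := Subtype.val ⁻¹' S) hp, ?_⟩
  · have h := hle ⟨s - p, hmem s (subset_affineSpan ℝ S hs)⟩ (by simpa [R] using hs)
    rw [hly]
    refine le_trans (le_of_eq ?_) (add_le_add_left h _)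
    rw [← hl]; simp
  · have := hf 0 h0
    rw [map_zero] at this
    linarith

/-- A functional strictly separating `w` from `S` would stay strictly separated after averaging with
the weights `c`. -/
theorem Convex.mem_of_hasSum [CompleteSpace E] {S : Set E} (hS : Convex ℝ S) (hc : IsClosed S)
    {c : ℕ → ℝ} {u : ℕ → E} {w : E} (hc0 : ∀ n, 0 ≤ c n) (hc1 : HasSum c 1)
    (hw : HasSum (fun n => c n • u n) w) (hu : ∀ n, u n ∈ S) : w ∈ S := by
  by_contra hwS
  obtain ⟨l, a, hla, haw⟩ := geometric_hahn_banach_closed_point hS hc hwS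
  have h₁ : HasSum (fun n => c n * l (u n)) (l w) := by simpa using hw.mapL l
  have h₂ : HasSum (fun n => c n * a) a := by simpa using hc1.mul_right a
  exact absurd (hasSum_le (fun n => mul_le_mul_of_nonneg_left (hla _ (hu n)).le (hc0 n)) h₁ h₂)
    (not_le.2 haw)

/-- A strictly positive mean of a dense sequence in the closure of a convex set lies in its relative
interior. -/
theorem Convex.combo_hasSum_mem [FiniteDimensional ℝ E] {S : Set E} (hS : Convex ℝ S)
    {c : ℕ → ℝ} {u : ℕ → E} {w : E} (hc0 : ∀ n, 0 < c n) (hc1 : HasSum c 1)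
    (hw : HasSum (fun n => c n • u n) w) (hu : ∀ n, u n ∈ closure S)
    (hdense : S ⊆ closure (range u)) {v : E} (hv : v ∈ closure S) {δ : ℝ} (hδ : 0 < δ)
    (hδ1 : δ ≤ 1) : (1 - δ) • v + δ • w ∈ S := by
  have : CompleteSpace E := FiniteDimensional.complete ℝ E
  have hwS : w ∈ closure S := hS.closure.mem_of_hasSum isClosed_closure (fun n => (hc0 n).le) hc1 hw hu
  by_contra hy
  obtain ⟨l, hl, s, hs, hls⟩ := hS.exists_proper_separation
    (hS.closure hv hwS (sub_nonneg.2 hδ1) hδ.le (by ring)) hy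
  have hl' : ∀ x ∈ closure S, l x ≤ l ((1 - δ) • v + δ • w) := fun x hx =>
    closure_minimal hl (isClosed_Iic.preimage l.continuous) hx
  -- The point is a mean of `v` and `w` that maximises `l` over the closure, and `w` has positive
  -- weight, so `w` is a maximiser too.
  have hlw : l w = l ((1 - δ) • v + δ • w) := by
    refine le_antisymm (hl' w hwS) ?_
    have h₁ := hl' v hv
    simp only [map_add, map_smul, smul_eq_mul] at h₁ ⊢
    nlinarith
  rw [← hlw] at hl' hls
  -- Nonnegative terms with sum zero vanish, so `l` is constant on the dense sequence, contradicting
  -- proper separation.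
  have h₁ : HasSum (fun n => c n * (l w - l (u n))) 0 := by
    have h₂ : HasSum (fun n => c n * l (u n)) (l w) := by simpa using hw.mapL l
    simpa [mul_sub] using (hc1.mul_right (l w)).sub h₂
  have h₃ := (hasSum_zero_iff_of_nonneg
    (fun n => mul_nonneg (hc0 n).le (sub_nonneg.2 (hl' _ (hu n))))).1 h₁
  have h₄ : closure (range u) ⊆ {x | l x = l w} := by
    refine closure_minimal ?_ (isClosed_eq l.continuous continuous_const)
    rintro - ⟨n, rfl⟩
    have := congrFun h₃ n
    simp only [Pi.zero_apply, mul_eq_zero, (hc0 n).ne', false_or] at this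
    exact (sub_eq_zero.1 this).symm
  exact hls.ne (h₄ (hdense hs))

end RelativeInterior

/-! ### Dense families of selections; values that need not be closed -/

section DenseSelections

open Metric Set Filter

variable {T E : Type*} [TopologicalSpace T] [NormedAddCommGroup E] [NormedSpace ℝ E]

theorem IsOpen.exists_iUnion_isClosed_of_perfectlyNormal [PerfectlyNormalSpace T] {U : Set T}
    (hU : IsOpen U) : ∃ F : ℕ → Set T, (∀ n, IsClosed (F n)) ∧ U = ⋃ n, F n := by
  obtain ⟨f, hf, h⟩ := (PerfectlyNormalSpace.closed_gdelta hU.isClosed_compl).eq_iInter_nat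
  refine ⟨fun n => (f n)ᶜ, fun n => (hf n).isClosed_compl, ?_⟩
  rw [← compl_iInter, ← h, compl_compl]

open Classical in
/-- On perfectly normal spaces, a closed convex valued inner semicontinuous mapping has a countable
family of continuous selections that is dense in every value. -/
theorem InnerSemicontinuous.exists_seq_dense_selections [PerfectlyNormalSpace T]
    [ParacompactSpace T] [CompleteSpace E] [TopologicalSpace.SeparableSpace E] {S : T → Set E}
    (hS : InnerSemicontinuous S) (hconv : ∀ t, Convex ℝ (S t)) (hne : ∀ t, (S t).Nonempty)
    (hclosed : ∀ t, IsClosed (S t)) :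
    ∃ u : ℕ → C(T, E), (∀ n t, u n t ∈ S t) ∧ ∀ t, S t ⊆ closure (range fun n => u n t) := by
  let q := TopologicalSpace.denseSeq E
  let B : ℕ → ℕ → Set E := fun k m => ball (q k) (1 / ((m : ℝ) + 1))
  -- The set where `S t` meets a basic ball is open, hence a countable union of closed sets. On each
  -- closed piece the selection can be forced into the closed ball without losing inner
  -- semicontinuity.
  choose F hFc hF using fun k m =>
    (hS.isOpen_inter_nonempty (A := B k m) isOpen_ball).exists_iUnion_isClosed_of_perfectlyNormal
  have hsel : ∀ i : ℕ × ℕ × ℕ, ∃ g : C(T, E), ∀ t, g t ∈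
      if t ∈ F i.1 i.2.1 i.2.2 then closure (S t ∩ B i.1 i.2.1) else S t := by
    rintro ⟨k, m, n⟩
    refine InnerSemicontinuous.exists_continuous_selection
      (hS.ite (R := fun t => closure (S t ∩ B k m))
        (hS.inter_ball continuous_const _).closure
        (fun t => closure_minimal inter_subset_left (hclosed t)) (hFc k m n)) ?_ ?_ ?_
    · intro t
      split_ifs
      exacts [((hconv t).inter (convex_ball _ _)).closure, hconv t]
    · intro t
      split_ifs with h
      · have : t ∈ {t | (S t ∩ B k m).Nonempty} := by
          rw [hF k m]; exact mem_iUnion.2 ⟨n, h⟩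
        exact Set.Nonempty.closure this
      · exact hne t
    · intro t
      split_ifs
      exacts [isClosed_closure, hclosed t]
  choose g hg using hsel
  obtain ⟨e, he⟩ := exists_surjective_nat (ℕ × ℕ × ℕ)
  refine ⟨fun n => g (e n), fun n t => ?_, fun t x hx => ?_⟩
  · have := hg (e n) t
    split_ifs at this
    exacts [closure_minimal inter_subset_left (hclosed t) this, this]
  · refine Metric.mem_closure_iff.2 fun ε hε => ?_
    obtain ⟨m, hm⟩ := exists_nat_one_div_lt (half_pos hε)
    obtain ⟨k, hk⟩ := (TopologicalSpace.denseRange_denseSeq E).exists_dist_lt x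
      (Nat.one_div_pos_of_nat (α := ℝ) (n := m))
    have ht : t ∈ {t | (S t ∩ B k m).Nonempty} := ⟨x, hx, hk⟩
    rw [hF k m] at ht
    obtain ⟨n, hn⟩ := mem_iUnion.1 ht
    obtain ⟨j, hj⟩ := he (k, m, n)
    refine ⟨_, ⟨j, rfl⟩, ?_⟩
    have h := hg (k, m, n) t
    rw [if_pos hn] at h
    have h' : g (k, m, n) t ∈ closedBall (q k) (1 / ((m : ℝ) + 1)) :=
      closure_minimal (inter_subset_right.trans ball_subset_closedBall) isClosed_closedBall h
    rw [mem_closedBall] at h'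
    simp only [hj]
    have := dist_triangle_right x (g (k, m, n) t) (q k)
    linarith

/-- A strictly positive weighted mean of a sequence of continuous functions. -/
theorem exists_continuous_weighted_mean [CompleteSpace E] (u : ℕ → C(T, E)) :
    ∃ w : C(T, E), ∀ t, ∃ c : ℕ → ℝ, (∀ n, 0 < c n) ∧ HasSum c 1 ∧
      HasSum (fun n => c n • u n t) (w t) := by
  -- The factor `1 + ‖u n t‖` in the denominator lets one geometric series dominate both the weights
  -- and the weighted terms, uniformly in `t`.
  let b : ℕ → T → ℝ := fun n t => (1 / 2) ^ n / (1 + ‖u n t‖)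
  have hpos : ∀ n t, 0 < 1 + ‖u n t‖ := fun n t => by positivity
  have hb0 : ∀ n t, 0 < b n t := fun n t => by positivity
  have hbc : ∀ n, Continuous (b n) := fun n => by
    refine continuous_const.div (by fun_prop) fun t => (hpos n t).ne'
  have hb1 : ∀ n t, ‖b n t‖ ≤ (1 / 2) ^ n := fun n t => by
    rw [Real.norm_of_nonneg (hb0 n t).le]
    exact div_le_self (by positivity) (by linarith [norm_nonneg (u n t)])
  have hb2 : ∀ n t, ‖b n t • u n t‖ ≤ (1 / 2) ^ n := fun n t => by
    rw [norm_smul, Real.norm_of_nonneg (hb0 n t).le, div_mul_eq_mul_div, div_le_iff₀ (hpos n t)]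
    gcongr
    linarith
  have hs₁ : ∀ t, Summable fun n => b n t := fun t =>
    Summable.of_norm_bounded summable_geometric_two fun n => hb1 n t
  have hs₂ : ∀ t, Summable fun n => b n t • u n t := fun t =>
    Summable.of_norm_bounded summable_geometric_two fun n => hb2 n t
  have hΛ : ∀ t, 0 < ∑' n, b n t := fun t =>
    (hs₁ t).tsum_pos (fun n => (hb0 n t).le) 0 (hb0 0 t)
  refine ⟨⟨fun t => (∑' n, b n t)⁻¹ • ∑' n, b n t • u n t, ?_⟩, fun t =>
    ⟨fun n => (∑' n, b n t)⁻¹ * b n t, fun n => mul_pos (inv_pos.2 (hΛ t)) (hb0 n t), ?_, ?_⟩⟩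
  · refine ((continuous_tsum hbc summable_geometric_two hb1).inv₀ fun t => (hΛ t).ne').smul
      (continuous_tsum (fun n => (hbc n).smul (u n).continuous) summable_geometric_two hb2)
  · simpa [(hΛ t).ne'] using (hs₁ t).hasSum.mul_left (∑' n, b n t)⁻¹
  · simpa [mul_smul] using (hs₂ t).hasSum.const_smul (∑' n, b n t)⁻¹

/-- Selections of a convex-valued inner semicontinuous mapping come arbitrarily close to any point
of its values. -/
theorem InnerSemicontinuous.exists_continuous_selection_near [T2Space T] [NormalSpace T]
    [ParacompactSpace T] [FiniteDimensional ℝ E] {S : T → Set E} (hS : InnerSemicontinuous S)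
    (hconv : ∀ t, Convex ℝ (S t)) (hne : ∀ t, (S t).Nonempty)
    (h : PerfectlyNormalSpace T ∨ ∀ t, IsClosed (S t)) {t₀ : T} {x : E} (hx : x ∈ S t₀) {ε : ℝ}
    (hε : 0 < ε) : ∃ g : C(T, E), (∀ t, g t ∈ S t) ∧ dist (g t₀) x < ε := by
  have : CompleteSpace E := FiniteDimensional.complete ℝ E
  have : ProperSpace E := FiniteDimensional.proper ℝ E
  rcases h with h | h
  -- `u₀` passes exactly through `x` but only selects from the closures; adding a share `δ` of `w`
  -- brings it into `S`, moving it at `t₀` by only `δ * ‖w t₀ - x‖`.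
  · obtain ⟨u₀, hu₀, hu₀x⟩ := hS.closure.exists_continuous_selection_through
      (fun t => (hconv t).closure) (fun t => (hne t).closure) (fun t => isClosed_closure)
      (subset_closure hx)
    obtain ⟨u, hu, hud⟩ := hS.closure.exists_seq_dense_selections
      (fun t => (hconv t).closure) (fun t => (hne t).closure) (fun t => isClosed_closure)
    obtain ⟨w, hw⟩ := exists_continuous_weighted_mean u
    obtain ⟨δ, hδ, hδ1, hδε⟩ : ∃ δ : ℝ, 0 < δ ∧ δ ≤ 1 ∧ δ * ‖w t₀ - x‖ < ε := by
      refine ⟨min 1 (ε / (‖w t₀ - x‖ + 1)), by positivity, min_le_left _ _, ?_⟩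
      calc _ ≤ ε / (‖w t₀ - x‖ + 1) * ‖w t₀ - x‖ := by gcongr; exact min_le_right _ _
        _ < ε := by
          rw [div_mul_eq_mul_div, div_lt_iff₀ (by positivity)]
          nlinarith [norm_nonneg (w t₀ - x)]
    refine ⟨⟨fun t => (1 - δ) • u₀ t + δ • w t, by fun_prop⟩, fun t => ?_, ?_⟩
    · obtain ⟨c, hc0, hc1, hcw⟩ := hw t
      exact (hconv t).combo_hasSum_mem hc0 hc1 hcw (fun n => hu n t)
        (subset_closure.trans (hud t)) (hu₀ t) hδ hδ1
    · have : (1 - δ) • x + δ • w t₀ - x = δ • (w t₀ - x) := by module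
      simpa [dist_eq_norm, hu₀x, this, norm_smul, abs_of_pos hδ] using hδε
  · obtain ⟨g, hg, hgx⟩ := hS.exists_continuous_selection_through hconv hne h hx
    exact ⟨g, hg, by simpa [hgx] using hε⟩

end DenseSelections

/-! ### Cutting selections off to vanish at infinity -/

section Cutoff

open Metric Set Filter

variable {T : Type*} [TopologicalSpace T] {d : ℕ} {S : T → Set (EuclideanSpace ℝ (Fin d))}

/-- The function `y₀ + φ • (g - y₀)` is pointwise a convex combination, and differs from `y₀` by a
function of compact support. -/
theorem exists_continuousSelections_cutoff (hconv : ∀ t, Convex ℝ (S t))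
    {y₀ : ZeroAtInftyContinuousMap T (EuclideanSpace ℝ (Fin d))}
    (hy₀ : y₀ ∈ continuousSelections S) (φ : C(T, ℝ)) (hφ : HasCompactSupport φ)
    (hφ1 : ∀ t, φ t ∈ Icc (0 : ℝ) 1) (g : C(T, EuclideanSpace ℝ (Fin d)))
    (hg : ∀ t, φ t ≠ 0 → g t ∈ S t) :
    ∃ y ∈ continuousSelections S, ∀ t, y t = φ t • g t + (1 - φ t) • y₀ t := by
  have hc : HasCompactSupport fun t => φ t • (g t - y₀ t) := hφ.smul_right
  let z : ZeroAtInftyContinuousMap T (EuclideanSpace ℝ (Fin d)) :=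
    ⟨⟨fun t => φ t • (g t - y₀ t), by fun_prop⟩, hc.is_zero_at_infty⟩
  have hz : ∀ t, (y₀ + z) t = φ t • g t + (1 - φ t) • y₀ t := fun t => by
    change y₀ t + φ t • (g t - y₀ t) = _
    module
  refine ⟨y₀ + z, fun t => ?_, hz⟩
  rw [hz]
  by_cases h : φ t = 0
  · simpa [h] using hy₀ t
  · exact hconv t (hg t h) (hy₀ t) (hφ1 t).1 (sub_nonneg.2 (hφ1 t).2) (by ring)

/-- The values of the continuous selections vanishing at infinity are dense in every `S t`. -/
theorem InnerSemicontinuous.exists_continuousSelections_near [T2Space T] [LocallyCompactSpace T]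
    [SigmaCompactSpace T] (hS : InnerSemicontinuous S) (hconv : ∀ t, Convex ℝ (S t))
    (hne : (continuousSelections S).Nonempty)
    (h : PerfectlyNormalSpace T ∨ ∀ t, IsClosed (S t)) {t₀ : T} {x : EuclideanSpace ℝ (Fin d)}
    (hx : x ∈ S t₀) {ε : ℝ} (hε : 0 < ε) :
    ∃ y ∈ continuousSelections S, dist (y t₀) x < ε := by
  obtain ⟨y₀, hy₀⟩ := hne
  obtain ⟨g, hg, hgx⟩ := hS.exists_continuous_selection_near hconv (fun t => ⟨_, hy₀ t⟩) h hx hε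
  obtain ⟨φ, hφ1, hφc, -, hφ⟩ := exists_continuousMap_one_of_isCompact_subset_isOpen
    (isCompact_singleton (x := t₀)) isOpen_univ (subset_univ _)
  obtain ⟨y, hy, hyg⟩ := exists_continuousSelections_cutoff hconv hy₀ φ hφc hφ g fun t _ => hg t
  refine ⟨y, hy, ?_⟩
  rw [hyg, hφ1 (mem_singleton t₀)]
  simpa using hgx

end Cutoff

/-! ### Integrals of extended real functions with an integrable minorant -/

section EReal

open Filter

variable {T : Type*} [MeasurableSpace T] {μ : Measure T}

theorem ENNReal.ofReal_le_toENNReal {r : ℝ} {x : EReal} (h : (r : EReal) ≤ x) :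
    ENNReal.ofReal r ≤ x.toENNReal := by
  simpa using EReal.toENNReal_le_toENNReal h

theorem EReal.toENNReal_neg_le_ofReal {r : ℝ} {x : EReal} (h : (r : EReal) ≤ x) :
    (-x).toENNReal ≤ ENNReal.ofReal (-r) := by
  have := EReal.toENNReal_le_toENNReal (EReal.neg_le_neg_iff.2 h)
  rwa [← EReal.coe_neg, EReal.toENNReal_of_ne_top (EReal.coe_ne_top _), EReal.toReal_coe] at this

theorem lintegral_neg_toENNReal_ne_top {f : T → EReal} {g : T → ℝ} (hg : Integrable g μ)
    (hgf : ∀ᵐ t ∂μ, (g t : EReal) ≤ f t) : ∫⁻ t, (-f t).toENNReal ∂μ ≠ ⊤ :=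
  ne_top_of_le_ne_top hg.neg.lintegral_lt_top.ne
    (lintegral_mono_ae (hgf.mono fun _ h => EReal.toENNReal_neg_le_ofReal h))

/-- Lower integrals are monotone, so `f` need not be measurable. -/
theorem integral_le_erealIntegral {f : T → EReal} {g : T → ℝ} (hg : Integrable g μ)
    (hgf : ∀ᵐ t ∂μ, (g t : EReal) ≤ f t) : ((∫ t, g t ∂μ : ℝ) : EReal) ≤ erealIntegral μ f := by
  have h₁ : ∫⁻ t, ENNReal.ofReal (g t) ∂μ ≤ ∫⁻ t, (f t).toENNReal ∂μ :=
    lintegral_mono_ae (hgf.mono fun _ h => ENNReal.ofReal_le_toENNReal h)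
  have h₂ : ∫⁻ t, (-f t).toENNReal ∂μ ≤ ∫⁻ t, ENNReal.ofReal (-g t) ∂μ :=
    lintegral_mono_ae (hgf.mono fun _ h => EReal.toENNReal_neg_le_ofReal h)
  have hneg : ∫⁻ t, ENNReal.ofReal (-g t) ∂μ ≠ ⊤ := hg.neg.lintegral_lt_top.ne
  rw [integral_eq_lintegral_pos_part_sub_lintegral_neg_part hg, EReal.coe_sub,
    EReal.coe_ennreal_toReal hg.lintegral_lt_top.ne,
    EReal.coe_ennreal_toReal hneg]
  exact EReal.sub_le_sub (EReal.coe_ennreal_le_coe_ennreal_iff.2 h₁)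
    (EReal.coe_ennreal_le_coe_ennreal_iff.2 h₂)

/-- Integrating f⁺ + g⁻ = (f − g) + g⁺ + f⁻ in `ENNReal` avoids infinite differences; only f⁺ and f
− g can have infinite integral. -/
theorem erealIntegral_eq_add {f : T → EReal} {g : T → ℝ} (hf : AEMeasurable f μ)
    (hg : Integrable g μ) (hgf : ∀ t, (g t : EReal) ≤ f t) :
    erealIntegral μ f =
      ((∫⁻ t, (f t - g t).toENNReal ∂μ : ENNReal) : EReal) + ((∫ t, g t ∂μ : ℝ) : EReal) := by
  have hpt : ∀ t, (f t).toENNReal + ENNReal.ofReal (-g t) =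
      (f t - g t).toENNReal + ENNReal.ofReal (g t) + (-f t).toENNReal := by
    intro t
    have h := hgf t
    generalize f t = x at h
    generalize g t = r at h
    induction x with
    | bot => simp at h
    | top => simp
    | coe x =>
      have hx : r ≤ x := EReal.coe_le_coe_iff.1 h
      rw [← EReal.coe_sub, ← EReal.coe_neg]
      simp only [EReal.toENNReal_of_ne_top (EReal.coe_ne_top _), EReal.toReal_coe]
      rw [← ENNReal.toReal_eq_toReal_iff' (by finiteness) (by finiteness)]
      rw [ENNReal.toReal_add (by finiteness) (by finiteness),
        ENNReal.toReal_add (by finiteness) (by finiteness),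
        ENNReal.toReal_add (by finiteness) (by finiteness)]
      simp only [ENNReal.toReal_ofReal']
      rw [max_eq_left (sub_nonneg.2 hx)]
      have h₁ := max_zero_sub_max_neg_zero_eq_self x
      have h₂ := max_zero_sub_max_neg_zero_eq_self r
      linarith
  have hint : ∫⁻ t, (f t).toENNReal ∂μ + ∫⁻ t, ENNReal.ofReal (-g t) ∂μ =
      ∫⁻ t, (f t - g t).toENNReal ∂μ + ∫⁻ t, ENNReal.ofReal (g t) ∂μ +
        ∫⁻ t, (-f t).toENNReal ∂μ := by
    have hm : AEMeasurable (fun t => (-f t).toENNReal) μ := hf.neg.ereal_toENNReal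
    have hn : AEMeasurable (fun t => ENNReal.ofReal (-g t)) μ :=
      hg.1.aemeasurable.neg.ennreal_ofReal
    rw [← lintegral_add_right' _ hn,
      ← lintegral_add_right' _ hg.1.aemeasurable.ennreal_ofReal, ← lintegral_add_right' _ hm]
    exact lintegral_congr hpt
  have h₁ := lintegral_neg_toENNReal_ne_top hg (Eventually.of_forall hgf)
  have h₂ : ∫⁻ t, ENNReal.ofReal (g t) ∂μ ≠ ⊤ := hg.lintegral_lt_top.ne
  have h₃ : ∫⁻ t, ENNReal.ofReal (-g t) ∂μ ≠ ⊤ := hg.neg.lintegral_lt_top.ne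
  rw [erealIntegral, integral_eq_lintegral_pos_part_sub_lintegral_neg_part hg]
  generalize ∫⁻ t, (f t).toENNReal ∂μ = a at *
  generalize ∫⁻ t, (-f t).toENNReal ∂μ = b at *
  generalize ∫⁻ t, ENNReal.ofReal (g t) ∂μ = c at *
  generalize ∫⁻ t, ENNReal.ofReal (-g t) ∂μ = e at *
  generalize ∫⁻ t, (f t - g t).toENNReal ∂μ = F at *
  lift b to NNReal using h₁
  lift c to NNReal using h₂
  lift e to NNReal using h₃
  have hbR : (((b : NNReal) : ENNReal) : EReal) = ((b : ℝ) : EReal) := rfl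
  rcases eq_or_ne F ⊤ with rfl | hF
  · have : a = ⊤ := by simpa using hint
    subst this
    rw [hbR, EReal.coe_ennreal_top, EReal.top_sub_coe, EReal.top_add_coe]
  · have ha : a ≠ ⊤ := by
      rintro rfl
      exact (show F + c + b ≠ ⊤ by finiteness) (by rw [← hint]; simp)
    lift F to NNReal using hF
    lift a to NNReal using ha
    have h : (a : ℝ) + e = F + c + b := by exact_mod_cast hint
    change ((a : ℝ) : EReal) - ((b : ℝ) : EReal) = ((F : ℝ) : EReal) + (((c : ℝ) - (e : ℝ) : ℝ) : EReal)
    rw [← EReal.coe_sub, ← EReal.coe_add]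
    congr 1
    linarith

end EReal

/-! ### The pairing as an integral against the total variation -/

section PolarDensity

open Filter

variable {T : Type*} [MeasurableSpace T] {d : ℕ} (θ : VectorMeasure T (EuclideanSpace ℝ (Fin d)))

theorem measurable_polarDensity : Measurable (polarDensity θ) :=
  (WithLp.measurable_toLp 2 _).comp
    (measurable_pi_lambda _ fun _ => SignedMeasure.measurable_rnDeriv _ _)

theorem integrable_polarDensity : Integrable (polarDensity θ) θ.variation :=
  integrable_piLp_iff.2 fun _ => SignedMeasure.integrable_rnDeriv _ _

theorem component_absolutelyContinuous (i : Fin d) :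
    component θ i ≪ᵥ θ.variation.toENNRealVectorMeasure := fun s hs => by
  rw [component_apply, θ.absolutelyContinuous hs]
  rfl

theorem integrable_dot_polarDensity {f : T → EuclideanSpace ℝ (Fin d)}
    (hf : AEStronglyMeasurable f θ.variation) {C : ℝ} (hC : ∀ t, ‖f t‖ ≤ C) :
    Integrable (fun t => dot (f t) (polarDensity θ t)) θ.variation := by
  refine ((integrable_polarDensity θ).norm.const_mul C).mono'
    (hf.inner (integrable_polarDensity θ).1) (Eventually.of_forall fun t => ?_)
  exact (norm_inner_le_norm _ _).trans (by gcongr; exact hC t)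

theorem integrable_dot_continuous [TopologicalSpace T] [BorelSpace T]
    (y : ZeroAtInftyContinuousMap T (EuclideanSpace ℝ (Fin d))) :
    Integrable (fun t => dot (y t) (polarDensity θ t)) θ.variation :=
  integrable_dot_polarDensity θ y.continuous.measurable.aestronglyMeasurable
    fun t => y.toBCF.norm_coe_le_norm t

variable [IsFiniteMeasure θ.variation]

theorem setIntegral_polarDensity {s : Set T} (hs : MeasurableSet s) :
    ∫ t in s, polarDensity θ t ∂θ.variation = θ s := by
  ext i
  have hi : ∀ i, Integrable (fun t => polarDensity θ t i) (θ.variation.restrict s) := fun i =>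
    (SignedMeasure.integrable_rnDeriv (component θ i) θ.variation).integrableOn
  rw [eval_integral_piLp hi,
    ← component_apply, ← SignedMeasure.withDensityᵥ_rnDeriv_eq (component θ i) θ.variation
      (component_absolutelyContinuous θ i),
    withDensityᵥ_apply (SignedMeasure.integrable_rnDeriv _ _) hs]
  rfl

/-- On an indicator times a vector both sides are the scalar product of that vector with `θ s`;
additivity does the rest. -/
theorem integral_simpleFunc_eq_integral_dot (f : SimpleFunc T (EuclideanSpace ℝ (Fin d))) :
    θ.integral f (innerSL ℝ) = ∫ t, dot (f t) (polarDensity θ t) ∂θ.variation := by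
  have hint : ∀ f : SimpleFunc T (EuclideanSpace ℝ (Fin d)),
      Integrable (fun t => dot (f t) (polarDensity θ t)) θ.variation := fun f => by
    obtain ⟨C, hC⟩ := f.exists_forall_norm_le
    exact integrable_dot_polarDensity θ f.aestronglyMeasurable hC
  induction f using SimpleFunc.induction with
  | const c hs =>
    rename_i s
    have h : (fun t => dot (s.indicator (fun _ => c) t) (polarDensity θ t)) =
        s.indicator fun t => inner ℝ c (polarDensity θ t) := by
      ext t
      by_cases ht : t ∈ s <;> simp [dot, ht]
    have hfun : ⇑(SimpleFunc.piecewise s hs (SimpleFunc.const T c) (SimpleFunc.const T 0)) =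
        s.indicator fun _ => c := by
      ext t
      by_cases ht : t ∈ s <;> simp [ht]
    rw [hfun, VectorMeasure.integral_eq_setToFun, setToFun_indicator_const _ hs (measure_ne_top _ _), h,
      integral_indicator hs, integral_inner (integrable_polarDensity θ).integrableOn,
      setIntegral_polarDensity θ hs]
    rfl
  | @add f g _ hf hg =>
    rw [SimpleFunc.coe_add, VectorMeasure.integral_add f.integrable_of_isFiniteMeasure
      g.integrable_of_isFiniteMeasure, hf, hg, ← integral_add (hint f) (hint g)]
    simp [dot, inner_add_left]

/-- The integral of a bounded function against a vector measure, in terms of the density of the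
measure with respect to its variation. -/
theorem integral_eq_integral_dot {f : T → EuclideanSpace ℝ (Fin d)} (hf : Measurable f) {C : ℝ}
    (hC : ∀ t, ‖f t‖ ≤ C) :
    θ.integral f (innerSL ℝ) = ∫ t, dot (f t) (polarDensity θ t) ∂θ.variation := by
  let F : ℕ → SimpleFunc T (EuclideanSpace ℝ (Fin d)) := fun n =>
    SimpleFunc.approxOn f hf Set.univ 0 (Set.mem_univ _) n
  have hF : ∀ n t, ‖F n t‖ ≤ C + C := fun n t =>
    (SimpleFunc.norm_approxOn_zero_le hf (Set.mem_univ _) t n).trans (add_le_add (hC t) (hC t))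
  have hlim : ∀ t, Tendsto (fun n => F n t) atTop (𝓝 (f t)) := fun t =>
    SimpleFunc.tendsto_approxOn hf (Set.mem_univ _) (by simp)
  have h₁ : Tendsto (fun n => θ.integral (F n) (innerSL ℝ)) atTop
      (𝓝 (θ.integral f (innerSL ℝ))) :=
    VectorMeasure.tendsto_integral_of_dominated_convergence (fun _ => C + C)
      (fun n => (F n).aestronglyMeasurable) (integrable_const _)
      (fun n => Eventually.of_forall (hF n)) (Eventually.of_forall hlim)
  have h₂ : Tendsto (fun n => ∫ t, dot (F n t) (polarDensity θ t) ∂θ.variation) atTop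
      (𝓝 (∫ t, dot (f t) (polarDensity θ t) ∂θ.variation)) := by
    refine tendsto_integral_of_dominated_convergence (fun t => (C + C) * ‖polarDensity θ t‖)
      (fun n => (integrable_dot_polarDensity θ (F n).aestronglyMeasurable (hF n)).1)
      ((integrable_polarDensity θ).norm.const_mul _)
      (fun n => Eventually.of_forall fun t => ?_)
      (Eventually.of_forall fun t => (hlim t).inner tendsto_const_nhds)
    exact (norm_inner_le_norm _ _).trans (by gcongr; exact hF n t)
  simp only [integral_simpleFunc_eq_integral_dot] at h₁
  exact tendsto_nhds_unique h₁ h₂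

variable [TopologicalSpace T] [BorelSpace T]

theorem pairing_eq_integral (y : ZeroAtInftyContinuousMap T (EuclideanSpace ℝ (Fin d))) :
    pairing y θ = ∫ t, dot (y t) (polarDensity θ t) ∂θ.variation :=
  integral_eq_integral_dot θ y.continuous.measurable fun t => y.toBCF.norm_coe_le_norm t

theorem pairing_sub (y z : ZeroAtInftyContinuousMap T (EuclideanSpace ℝ (Fin d))) :
    pairing (y - z) θ = pairing y θ - pairing z θ := by
  rw [pairing_eq_integral, pairing_eq_integral, pairing_eq_integral,
    ← integral_sub (integrable_dot_continuous θ y) (integrable_dot_continuous θ z)]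
  simp [dot, inner_sub_left]

end PolarDensity

/-! ### Lusin's theorem -/

section Lusin

open Set Filter

/-- Lusin's theorem. -/
theorem Measurable.exists_isCompact_continuousOn {T X : Type*} [TopologicalSpace T] [T2Space T]
    [MeasurableSpace T] [BorelSpace T] {μ : Measure T} [IsFiniteMeasure μ]
    [μ.InnerRegularCompactLTTop] [TopologicalSpace X] [SecondCountableTopology X]
    [MeasurableSpace X] [OpensMeasurableSpace X] {f : T → X} (hf : Measurable f) {ε : ENNReal}
    (hε : ε ≠ 0) : ∃ K, IsCompact K ∧ ContinuousOn f K ∧ μ Kᶜ < ε := by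
  have hε2 : ε / 2 ≠ 0 := by simpa using hε
  obtain ⟨b, hbc, -, hb⟩ := TopologicalSpace.exists_countable_basis X
  have : Countable b := hbc
  obtain ⟨δ, hδ, hδε⟩ := ENNReal.exists_pos_sum_of_countable' (ε := ε / 2) hε2 b
  have hδ2 : ∀ V : b, δ V / 2 ≠ 0 := fun V => by simpa using (hδ V).ne'
  have hm : ∀ V : b, MeasurableSet (f ⁻¹' V) := fun V => hf (hb.isOpen V.2).measurableSet
  -- Compact sets approximate each basic preimage and its complement from inside. On the final set
  -- the preimage of `V` is the complement of the closed set `L V`, hence relatively open.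
  choose K hKV hK hKμ using fun V : b =>
    (hm V).exists_isCompact_sdiff_lt (μ := μ) (measure_ne_top _ _) (hδ2 V)
  choose L hLV hL hLμ using fun V : b =>
    (hm V).compl.exists_isCompact_sdiff_lt (μ := μ) (measure_ne_top _ _) (hδ2 V)
  obtain ⟨M, -, hM, hMμ⟩ :=
    MeasurableSet.univ.exists_isCompact_sdiff_lt (μ := μ) (measure_ne_top _ _) hε2
  refine ⟨M ∩ ⋂ V, (K V ∪ L V),
    hM.inter_right (isClosed_iInter fun V => ((hK V).union (hL V)).isClosed), ?_, ?_⟩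
  · intro x hx
    refine (hb.nhds_hasBasis.tendsto_right_iff).2 fun V ⟨hV, hxV⟩ => ?_
    have hxL : x ∈ (L ⟨V, hV⟩)ᶜ := fun h => hLV _ h hxV
    filter_upwards [self_mem_nhdsWithin,
      mem_nhdsWithin_of_mem_nhds ((hL ⟨V, hV⟩).isClosed.isOpen_compl.mem_nhds hxL)] with s hs hsL
    exact hKV ⟨V, hV⟩ ((mem_iInter.1 hs.2 ⟨V, hV⟩).resolve_right hsL)
  · have hV : ∀ V : b, μ (K V ∪ L V)ᶜ ≤ δ V := fun V => by
      calc μ (K V ∪ L V)ᶜ ≤ μ ((f ⁻¹' V \ K V) ∪ ((f ⁻¹' V)ᶜ \ L V)) := by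
            refine measure_mono fun t ht => ?_
            simp only [mem_compl_iff, mem_union, not_or] at ht
            by_cases h : t ∈ f ⁻¹' (V : Set X)
            exacts [Or.inl ⟨h, ht.1⟩, Or.inr ⟨h, ht.2⟩]
        _ ≤ δ V / 2 + δ V / 2 := (measure_union_le _ _).trans (add_le_add (hKμ V).le (hLμ V).le)
        _ = δ V := ENNReal.add_halves _
    calc μ (M ∩ ⋂ V, (K V ∪ L V))ᶜ ≤ μ (univ \ M) + μ (⋃ V, (K V ∪ L V)ᶜ) := by
          rw [compl_inter, compl_iInter, ← compl_eq_univ_sdiff]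
          exact measure_union_le _ _
      _ ≤ μ (univ \ M) + ∑' V, δ V := by
          gcongr
          exact (measure_iUnion_le _).trans (ENNReal.tsum_le_tsum hV)
      _ < ε / 2 + ε / 2 := ENNReal.add_lt_add hMμ hδε
      _ = ε := ENNReal.add_halves _

end Lusin

/-! ### Dirac measures as test measures -/

section Dirac

theorem regular_dirac {T : Type*} [TopologicalSpace T] [T1Space T] [MeasurableSpace T]
    [BorelSpace T] (t : T) : (Measure.dirac t).Regular where
  outerRegular A hA r hr := by
    by_cases ht : t ∈ A
    · exact ⟨Set.univ, Set.subset_univ _, isOpen_univ, by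
        rw [Measure.dirac_apply' _ hA] at hr; simpa [ht] using hr⟩
    · exact ⟨{t}ᶜ, fun s hs h => ht (h ▸ hs), isOpen_compl_singleton, by
        rw [Measure.dirac_apply' _ hA] at hr; simpa [ht] using hr⟩
  innerRegular U hU r hr := by
    rw [Measure.dirac_apply' _ hU.measurableSet] at hr
    by_cases ht : t ∈ U
    · exact ⟨{t}, Set.singleton_subset_iff.2 ht, isCompact_singleton, by simpa [ht] using hr⟩
    · simp [ht] at hr

theorem dirac_mem_regularVectorMeasures {T : Type*} [TopologicalSpace T] [T1Space T]
    [MeasurableSpace T] [BorelSpace T] {d : ℕ} (t : T) (v : EuclideanSpace ℝ (Fin d)) :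
    VectorMeasure.dirac t v ∈ regularVectorMeasures T d := by
  have := regular_dirac t
  rw [regularVectorMeasures, Set.mem_ofPred_eq, VectorMeasure.variation_dirac]
  exact ⟨Measure.smul_finite _ enorm_ne_top, Measure.Regular.smul enorm_ne_top⟩

end Dirac

/-! ### Measurability of the integrand and consequences of the representation -/

section SupportFunctions

open Set Filter

theorem le_supportFun {X Y : Type*} {B : X → Y → ℝ} {A : Set X} {x : X} (hx : x ∈ A) (y : Y) :
    (B x y : EReal) ≤ supportFun B A y :=
  le_iSup₂ (f := fun x (_ : x ∈ A) => (B x y : EReal)) x hx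

theorem lt_supportFun_iff {X Y : Type*} {B : X → Y → ℝ} {A : Set X} {y : Y} {c : EReal} :
    c < supportFun B A y ↔ ∃ x ∈ A, c < B x y := by
  simp [supportFun, lt_iSup_iff]

theorem supportFun_le_iff {X Y : Type*} {B : X → Y → ℝ} {A : Set X} {y : Y} {c : EReal} :
    supportFun B A y ≤ c ↔ ∀ x ∈ A, (B x y : EReal) ≤ c :=
  iSup₂_le_iff

theorem mem_normals_iff_supportFun_le {X Y : Type*} [Sub X] {B : X → Y → ℝ} {A : Set X} {y : Y}
    (hB : ∀ x x', B (x - x') y = B x y - B x' y) {x : X} (hx : x ∈ A) :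
    y ∈ normals B A x ↔ supportFun B A y ≤ B x y := by
  simp [normals, hx, supportFun_le_iff, hB]

variable {T : Type*} [TopologicalSpace T] {d : ℕ} {S : T → Set (EuclideanSpace ℝ (Fin d))}

theorem continuous_dot :
    Continuous fun z : EuclideanSpace ℝ (Fin d) × EuclideanSpace ℝ (Fin d) => dot z.1 z.2 :=
  continuous_inner

/-- A vector `v` of `S t` exceeding the level `c` has nearby vectors in the neighbouring values,
which still exceed `c` for nearby arguments. -/
theorem InnerSemicontinuous.lowerSemicontinuous_supportFun (hS : InnerSemicontinuous S) :
    LowerSemicontinuous fun z : T × EuclideanSpace ℝ (Fin d) => supportFun dot (S z.1) z.2 := by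
  rintro ⟨t, x⟩ c hc
  obtain ⟨v, hv, hcv⟩ := lt_supportFun_iff.1 hc
  have hopen : IsOpen {z : EuclideanSpace ℝ (Fin d) × EuclideanSpace ℝ (Fin d) |
      c < (dot z.1 z.2 : EReal)} :=
    isOpen_lt continuous_const (continuous_coe_real_ereal.comp continuous_dot)
  obtain ⟨A, B, hA, hB, hvA, hxB, hAB⟩ := isOpen_prod_iff.1 hopen v x hcv
  filter_upwards [prod_mem_nhds (hS t hv A hA hvA) (hB.mem_nhds hxB)]
    with z ⟨⟨u, hu, huA⟩, hzB⟩
  exact lt_supportFun_iff.2 ⟨u, hu, hAB (mk_mem_prod huA hzB)⟩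

variable [MeasurableSpace T] (θ : VectorMeasure T (EuclideanSpace ℝ (Fin d)))

theorem dot_le_supportIntegrand {y : ZeroAtInftyContinuousMap T (EuclideanSpace ℝ (Fin d))}
    (hy : y ∈ continuousSelections S) (t : T) :
    (dot (y t) (polarDensity θ t) : EReal) ≤ supportIntegrand S θ t :=
  le_supportFun (hy t) _

variable [BorelSpace T]

theorem InnerSemicontinuous.measurable_supportIntegrand (hS : InnerSemicontinuous S) :
    Measurable (supportIntegrand S θ) :=
  hS.lowerSemicontinuous_supportFun.measurable.comp
    (measurable_id.prodMk (measurable_polarDensity θ))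

/-- The representation on Dirac measures forces the values of the continuous selections to be dense
in every `S t`. -/
theorem HasIntegralRepresentation.innerSemicontinuous [T2Space T] (hconv : ∀ t, Convex ℝ (S t))
    (hR : HasIntegralRepresentation S) : InnerSemicontinuous S := by
  intro t x hx A hA hxA
  let Y : Set (EuclideanSpace ℝ (Fin d)) := {v | ∃ y ∈ continuousSelections S, y t = v}
  have hY : Convex ℝ Y := by
    rintro _ ⟨y, hy, rfl⟩ _ ⟨z, hz, rfl⟩ a b ha hb hab
    exact ⟨a • y + b • z, fun s => hconv s (hy s) (hz s) ha hb hab, rfl⟩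
  have hxY : x ∈ closure Y := by
    by_contra hxY
    obtain ⟨f, u, hfu, hux⟩ := geometric_hahn_banach_closed_point hY.closure isClosed_closure hxY
    obtain ⟨v, rfl⟩ := (InnerProductSpace.toDual ℝ (EuclideanSpace ℝ (Fin d))).surjective f
    set θ := VectorMeasure.dirac t v with hθ
    have hθM : θ ∈ regularVectorMeasures T d := dirac_mem_regularVectorMeasures t v
    have := hθM.1
    have hpos : ((inner ℝ x v : ℝ) : EReal) ≤ erealIntegral θ.variation (supportIntegrand S θ) := by
      -- The density is never computed: its total integral is `v`, and the comparison with the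
      -- integrand is needed only at the atom `t`, where `x ∈ S t`.
      have hint : Integrable (fun s => inner ℝ x (polarDensity θ s)) θ.variation :=
        (integrable_polarDensity θ).const_inner x
      have hval : ∫ s, inner ℝ x (polarDensity θ s) ∂θ.variation = inner ℝ x v := by
        rw [integral_inner (integrable_polarDensity θ), ← setIntegral_univ,
          setIntegral_polarDensity θ MeasurableSet.univ, hθ,
          VectorMeasure.dirac_apply_of_mem MeasurableSet.univ (mem_univ t)]
      rw [← hval]
      refine integral_le_erealIntegral hint ?_
      rw [hθ, VectorMeasure.variation_dirac]
      refine Measure.ae_smul_measure ?_ _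
      rw [ae_dirac_eq]
      exact le_supportFun (B := dot) hx _
    rw [← hR θ hθM] at hpos
    have hle : supportFun pairing (continuousSelections S) θ ≤ (u : EReal) := by
      refine supportFun_le_iff.2 fun y hy => EReal.coe_le_coe_iff.2 ?_
      have h₁ : pairing y θ = inner ℝ (y t) v := by
        rw [pairing, hθ, VectorMeasure.integral_dirac]
        rfl
      rw [h₁, real_inner_comm]
      exact (hfu (y t) (subset_closure ⟨y, hy, rfl⟩)).le
    have hux' : u < inner ℝ x v := by rw [real_inner_comm]; exact hux
    exact absurd (EReal.coe_le_coe_iff.1 (hpos.trans hle)) (not_le.2 hux')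
  obtain ⟨_, hyA, y, hy, rfl⟩ := mem_closure_iff.1 hxY A hA hxA
  filter_upwards [(hA.preimage y.continuous).mem_nhds hyA] with s hs
  exact ⟨y s, hy s, hs⟩

theorem pairing_le_erealIntegral [IsFiniteMeasure θ.variation]
    {y : ZeroAtInftyContinuousMap T (EuclideanSpace ℝ (Fin d))} (hy : y ∈ continuousSelections S) :
    (pairing y θ : EReal) ≤ erealIntegral θ.variation (supportIntegrand S θ) := by
  rw [pairing_eq_integral]
  exact integral_le_erealIntegral (integrable_dot_continuous θ y)
    (Eventually.of_forall (dot_le_supportIntegrand θ hy))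

/-- Splitting off one selection leaves a nonnegative gap, which turns both the lower bound in (R)
and the normality criterion into statements about a `lintegral`. -/
theorem InnerSemicontinuous.erealIntegral_supportIntegrand [IsFiniteMeasure θ.variation]
    (hS : InnerSemicontinuous S) {y : ZeroAtInftyContinuousMap T (EuclideanSpace ℝ (Fin d))}
    (hy : y ∈ continuousSelections S) :
    erealIntegral θ.variation (supportIntegrand S θ) =
      ((∫⁻ t, (supportIntegrand S θ t - dot (y t) (polarDensity θ t)).toENNReal ∂θ.variation :
        ENNReal) : EReal) + (pairing y θ : EReal) := by
  rw [pairing_eq_integral]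
  exact erealIntegral_eq_add (hS.measurable_supportIntegrand θ).aemeasurable
    (integrable_dot_continuous θ y) (dot_le_supportIntegrand θ hy)

/-- Pointwise description of the normals to `C(S)` if the representation holds. -/
theorem HasIntegralRepresentation.mem_normals_iff [T2Space T] (hconv : ∀ t, Convex ℝ (S t))
    (hR : HasIntegralRepresentation S) (hθ : θ ∈ regularVectorMeasures T d)
    {y : ZeroAtInftyContinuousMap T (EuclideanSpace ℝ (Fin d))} (hy : y ∈ continuousSelections S) :
    θ ∈ normals pairing (continuousSelections S) y ↔
      ∀ᵐ t ∂θ.variation, polarDensity θ t ∈ normals dot (S t) (y t) := by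
  have := hθ.1
  have hS := hR.innerSemicontinuous hconv
  have hm : Measurable fun t =>
      (supportIntegrand S θ t - dot (y t) (polarDensity θ t)).toENNReal :=
    (((hS.measurable_supportIntegrand θ)).sub
      ((continuous_dot.measurable.comp
        (y.continuous.measurable.prodMk (measurable_polarDensity θ))).coe_real_ereal)).ereal_toENNReal
  rw [mem_normals_iff_supportFun_le (fun x x' => pairing_sub θ x x') hy, hR θ hθ,
    hS.erealIntegral_supportIntegrand θ hy]
  calc _ ↔ ∫⁻ t, (supportIntegrand S θ t - dot (y t) (polarDensity θ t)).toENNReal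
        ∂θ.variation = 0 := by
        generalize ∫⁻ t, (supportIntegrand S θ t - dot (y t) (polarDensity θ t)).toENNReal
          ∂θ.variation = F
        induction F with
        | top => simp
        | coe F =>
          change ((F : ℝ) : EReal) + _ ≤ _ ↔ _
          rw [← EReal.coe_add, EReal.coe_le_coe_iff]
          rw [add_le_iff_nonpos_left, ENNReal.coe_eq_zero]
          exact_mod_cast nonpos_iff_eq_zero
    _ ↔ _ := by
      rw [lintegral_eq_zero_iff hm]
      refine eventually_congr (Eventually.of_forall fun t => ?_)
      rw [mem_normals_iff_supportFun_le (B := dot) (fun x x' => inner_sub_left x x' _) (hy t),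
        Pi.zero_apply, EReal.toENNReal_eq_zero_iff, EReal.sub_nonpos]
      rfl

end SupportFunctions

/-! ### From inner semicontinuity to the representation -/

section Representation

open Set Filter

variable {T : Type*} [TopologicalSpace T] [T2Space T] [LocallyCompactSpace T] [SigmaCompactSpace T]
  {d : ℕ} {S : T → Set (EuclideanSpace ℝ (Fin d))}

/-- If `p` and `h` are continuous on the compact set `K` and `h` lies strictly below the support
function along `p`, then some continuous selection strictly exceeds `h` on `K`. -/
theorem exists_continuousSelections_lt_dot (hconv : ∀ t, Convex ℝ (S t))
    (hne : (continuousSelections S).Nonempty)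
    (hdense : ∀ t, ∀ x ∈ S t, ∀ ε > 0, ∃ y ∈ continuousSelections S, dist (y t) x < ε)
    {K : Set T} (hK : IsCompact K) {p : T → EuclideanSpace ℝ (Fin d)} (hp : ContinuousOn p K)
    {h : T → ℝ} (hh : ContinuousOn h K) (hlt : ∀ t ∈ K, (h t : EReal) < supportFun dot (S t) (p t)) :
    ∃ y ∈ continuousSelections S, ∀ t ∈ K, h t < dot (y t) (p t) := by
  obtain ⟨y₀, hy₀⟩ := hne
  obtain ⟨g, hg⟩ := exists_continuous_forall_mem_convex_of_local
    (t := fun t => {v | v ∈ S t ∧ (t ∈ K → h t < dot v (p t))}) (fun t => by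
      refine (hconv t).inter ?_
      intro v hv w hw a b ha hb hab htK
      have h₁ := hv htK
      have h₂ := hw htK
      simp only [dot, inner_add_left, real_inner_smul_left] at h₁ h₂ ⊢
      rcases ha.eq_or_lt with rfl | ha
      · obtain rfl : b = 1 := by linarith
        simpa using h₂
      · obtain rfl : b = 1 - a := by linarith
        nlinarith [mul_lt_mul_of_pos_left h₁ ha, mul_le_mul_of_nonneg_left h₂.le hb])
    (fun t => by
      by_cases htK : t ∈ K
      · obtain ⟨v, hv, hhv⟩ := lt_supportFun_iff.1 (hlt t htK)
        have hopen : IsOpen {v : EuclideanSpace ℝ (Fin d) | h t < dot v (p t)} :=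
          isOpen_lt continuous_const (continuous_dot.comp (Continuous.prodMk_left (p t)))
        -- A selection whose value at `t` is close to `v` beats `h` at `t`, hence by continuity on
        -- `K` near `t`.
        obtain ⟨ε, hε, hball⟩ := Metric.isOpen_iff.1 hopen v (EReal.coe_lt_coe_iff.1 hhv)
        obtain ⟨y, hy, hyv⟩ := hdense t v hv ε hε
        have hcont : ContinuousWithinAt (fun s => dot (y s) (p s)) K t :=
          y.continuous.continuousWithinAt.inner (hp t htK)
        have hev : ∀ᶠ s in 𝓝[K] t, h s < dot (y s) (p s) :=
          (hh t htK).eventually_lt hcont (hball (Metric.mem_ball.2 hyv))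
        exact ⟨_, eventually_nhdsWithin_iff.1 hev, y, y.continuous.continuousOn,
          fun s hs => ⟨hy s, hs⟩⟩
      · exact ⟨Kᶜ, hK.isClosed.isOpen_compl.mem_nhds htK, y₀, y₀.continuous.continuousOn,
          fun s hs => ⟨hy₀ s, fun hsK => absurd hsK hs⟩⟩)
  obtain ⟨φ, hφ1, hφc, -, hφ⟩ :=
    exists_continuousMap_one_of_isCompact_subset_isOpen hK isOpen_univ (subset_univ _)
  obtain ⟨y, hy, hyg⟩ := exists_continuousSelections_cutoff hconv hy₀ φ hφc hφ g
    fun t _ => (hg t).1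
  refine ⟨y, hy, fun t ht => ?_⟩
  rw [hyg, hφ1 ht]
  simpa using (hg t).2 ht

variable [MeasurableSpace T] [BorelSpace T] (θ : VectorMeasure T (EuclideanSpace ℝ (Fin d)))

/-- If the real function `h` lies strictly below the integrand relative to the selection `y₀`, then
the integral of `h` is almost attained by another continuous selection. -/
theorem exists_continuousSelections_integral_lt_pairing (hconv : ∀ t, Convex ℝ (S t))
    (hθ : θ ∈ regularVectorMeasures T d)
    (hdense : ∀ t, ∀ x ∈ S t, ∀ ε > 0, ∃ y ∈ continuousSelections S, dist (y t) x < ε)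
    {y₀ : ZeroAtInftyContinuousMap T (EuclideanSpace ℝ (Fin d))}
    (hy₀ : y₀ ∈ continuousSelections S) {h : T → ℝ} (hm : Measurable h)
    (hint : Integrable h θ.variation)
    (hlt : ∀ t, ((dot (y₀ t) (polarDensity θ t) + h t : ℝ) : EReal) < supportIntegrand S θ t)
    {ε : ℝ} (hε : 0 < ε) :
    ∃ y ∈ continuousSelections S,
      pairing y₀ θ + ∫ t, h t ∂θ.variation - ε < pairing y θ := by
  have := hθ.1
  have := hθ.2
  set μ := θ.variation with hμ
  set p := polarDensity θ
  have hε2 : ENNReal.ofReal (ε / 2) ≠ 0 := by simpa using half_pos hε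
  obtain ⟨δ, hδ, hδh⟩ := exists_pos_setLIntegral_lt_of_measure_lt
    (μ := μ) (f := fun t => ‖h t‖ₑ) hint.2.ne hε2
  obtain ⟨K, hK, hKc, hKμ⟩ := ((measurable_polarDensity θ).prodMk hm).exists_isCompact_continuousOn
    (μ := μ) hδ.ne'
  have hpK : ContinuousOn p K := continuous_fst.comp_continuousOn hKc
  have hhK : ContinuousOn h K := continuous_snd.comp_continuousOn hKc
  obtain ⟨z, hz, hzK⟩ := exists_continuousSelections_lt_dot hconv ⟨y₀, hy₀⟩ hdense hK hpK
    (h := fun t => dot (y₀ t) (p t) + h t)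
    ((y₀.continuous.continuousOn.inner hpK).add hhK) (fun t _ => hlt t)
  set q : T → ℝ := fun t => dot (z t) (p t) - dot (y₀ t) (p t) with hq
  have hqint : Integrable q μ :=
    (integrable_dot_continuous θ z).sub (integrable_dot_continuous θ y₀)
  -- `q` depends on `z` and so on `K`; hence the neighbourhood `U` is tightened only now, to make
  -- the integral of `|q|` over `U \ K` small.
  obtain ⟨η, hη, hηq⟩ := exists_pos_setLIntegral_lt_of_measure_lt
    (μ := μ) (f := fun t => ‖q t‖ₑ) hqint.2.ne hε2
  obtain ⟨U, hKU, hU, -, hUμ⟩ :=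
    hK.measurableSet.exists_isOpen_sdiff_lt (μ := μ) (measure_ne_top _ _) hη.ne'
  obtain ⟨φ, hφ1, hφc, hφU, hφ⟩ := exists_continuousMap_one_of_isCompact_subset_isOpen hK hU hKU
  obtain ⟨y, hy, hyg⟩ := exists_continuousSelections_cutoff hconv hy₀ φ hφc hφ
    (z : C(T, EuclideanSpace ℝ (Fin d))) fun t _ => hz t
  have hsmall : ∀ {f : T → ℝ} {A : Set T}, Integrable f μ → MeasurableSet A →
      ∫⁻ t in A, ‖f t‖ₑ ∂μ < ENNReal.ofReal (ε / 2) →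
      ∫ t, A.indicator (fun t => ‖f t‖) t ∂μ < ε / 2 := fun {f A} hf hA hlt => by
    rw [integral_indicator hA, integral_norm_eq_lintegral_enorm hf.1.restrict]
    exact (ENNReal.lt_ofReal_iff_toReal_lt hlt.ne_top).1 hlt
  have h₁ := hsmall hint hK.measurableSet.compl (hδh _ hKμ)
  have h₂ := hsmall hqint (hU.measurableSet.diff hK.measurableSet) (hηq _ hUμ)
  have hi₁ := hint.norm.indicator (hK.measurableSet.compl)
  have hi₂ := hqint.norm.indicator (hU.measurableSet.diff hK.measurableSet)
  -- On `K` the selection beats the target; off `K` the loss is at most `‖h‖`, plus `‖q‖` on `U`,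
  -- because `y` agrees with `y₀` outside `U`.
  have hpt : ∀ t, dot (y₀ t) (p t) + h t - Kᶜ.indicator (fun t => ‖h t‖) t -
      (U \ K).indicator (fun t => ‖q t‖) t ≤ dot (y t) (p t) := by
    intro t
    have hyq : dot (y t) (p t) = dot (y₀ t) (p t) + φ t * q t := by
      rw [hyg, hq]
      simp only [dot, inner_add_left, real_inner_smul_left]
      change φ t * inner ℝ (z t) (p t) + _ = _
      ring
    rw [hyq]
    by_cases htK : t ∈ K
    · have := hzK t htK
      have hK₁ : t ∉ Kᶜ := fun h => h htK
      have hK₂ : t ∉ U \ K := fun h => h.2 htK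
      rw [indicator_of_notMem hK₁, indicator_of_notMem hK₂, hφ1 htK, hq, Pi.one_apply]
      linarith
    · rw [indicator_of_mem (show t ∈ Kᶜ from htK)]
      have hh := le_abs_self (h t)
      rw [← Real.norm_eq_abs] at hh
      by_cases htU : t ∈ U
      · rw [indicator_of_mem (show t ∈ U \ K from ⟨htU, htK⟩)]
        have h₃ := neg_abs_le (q t)
        rw [← Real.norm_eq_abs] at h₃
        have h₄ : -‖q t‖ ≤ φ t * q t := by
          nlinarith [(hφ t).1, (hφ t).2, norm_nonneg (q t)]
        linarith
      · rw [indicator_of_notMem (fun h => htU h.1),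
          image_eq_zero_of_notMem_tsupport (fun h => htU (hφU h))]
        linarith
  have hI₀ := integrable_dot_continuous θ y₀
  have hle := integral_mono (((hI₀.add hint).sub hi₁).sub hi₂) (integrable_dot_continuous θ y) hpt
  rw [← pairing_eq_integral] at hle
  have heq : ∫ t, (dot (y₀ t) (p t) + h t - Kᶜ.indicator (fun t => ‖h t‖) t -
      (U \ K).indicator (fun t => ‖q t‖) t) ∂μ = pairing y₀ θ + ∫ t, h t ∂μ -
      ∫ t, Kᶜ.indicator (fun t => ‖h t‖) t ∂μ - ∫ t, (U \ K).indicator (fun t => ‖q t‖) t ∂μ := by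
    have hA : Integrable (fun t => dot (y₀ t) (p t) + h t) μ := hI₀.add hint
    have hB : Integrable (fun t => dot (y₀ t) (p t) + h t - Kᶜ.indicator (fun t => ‖h t‖) t) μ :=
      hA.sub hi₁
    rw [integral_sub hB hi₂, integral_sub hA hi₁, integral_add hI₀ hint, pairing_eq_integral]
  refine ⟨y, hy, lt_of_lt_of_le ?_ (heq ▸ hle)⟩
  linarith

/-- Inner semicontinuity with pointwise dense continuous selections yields the representation. -/
theorem InnerSemicontinuous.hasIntegralRepresentation (hS : InnerSemicontinuous S)
    (hconv : ∀ t, Convex ℝ (S t)) (hne : (continuousSelections S).Nonempty)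
    (hdense : ∀ t, ∀ x ∈ S t, ∀ ε > 0, ∃ y ∈ continuousSelections S, dist (y t) x < ε) :
    HasIntegralRepresentation S := by
  intro θ hθ
  have := hθ.1
  refine le_antisymm (supportFun_le_iff.2 fun y hy => pairing_le_erealIntegral θ hy) ?_
  obtain ⟨y₀, hy₀⟩ := hne
  rw [hS.erealIntegral_supportIntegrand θ hy₀]
  set μ := θ.variation
  set F : T → ENNReal := fun t =>
    (supportIntegrand S θ t - dot (y₀ t) (polarDensity θ t)).toENNReal
  have hφint : ∀ φ : SimpleFunc T NNReal, Integrable (fun t => (φ t : ℝ)) μ := fun φ =>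
    (φ.map ((↑) : NNReal → ℝ)).integrable_of_isFiniteMeasure
  have key : ∀ φ : SimpleFunc T NNReal, (∀ t, (φ t : ENNReal) ≤ F t) →
      ((∫ t, (φ t : ℝ) ∂μ + pairing y₀ θ : ℝ) : EReal) ≤
        supportFun pairing (continuousSelections S) θ := by
    intro φ hφ
    by_contra! hc
    obtain ⟨c, hc₁, hc₂⟩ := EReal.lt_iff_exists_real_btwn.1 hc
    have hε : 0 < ∫ t, (φ t : ℝ) ∂μ + pairing y₀ θ - c :=
      sub_pos.2 (EReal.coe_lt_coe_iff.1 hc₂)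
    set ε := ∫ t, (φ t : ℝ) ∂μ + pairing y₀ θ - c with hε_def
    -- Subtracting `η` makes the inequality strict at a total cost of at most `ε / 2`; the `+ 1`
    -- covers the zero measure.
    set η := ε / 2 / (μ.real univ + 1)
    have hη : 0 < η := by positivity
    have hημ : μ.real univ * η ≤ ε / 2 := by
      rw [mul_div_assoc', div_le_iff₀ (by positivity)]
      nlinarith [measureReal_nonneg (μ := μ) (s := univ)]
    have hlt : ∀ t, ((dot (y₀ t) (polarDensity θ t) + ((φ t : ℝ) - η) : ℝ) : EReal) <
        supportIntegrand S θ t := by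
      intro t
      have h₁ := hφ t
      have h₂ := dot_le_supportIntegrand θ hy₀ t
      simp only [F] at h₁
      generalize supportIntegrand S θ t = x at h₁ h₂
      induction x with
      | bot => simp at h₂
      | top => exact EReal.coe_lt_top _
      | coe x =>
        rw [← EReal.coe_sub, EReal.toENNReal_of_ne_top (EReal.coe_ne_top _), EReal.toReal_coe,
          ← ENNReal.ofReal_coe_nnreal,
          ENNReal.ofReal_le_ofReal_iff (sub_nonneg.2 (EReal.coe_le_coe_iff.1 h₂))] at h₁
        rw [EReal.coe_lt_coe_iff]
        linarith
    obtain ⟨y, hy, hyφ⟩ := exists_continuousSelections_integral_lt_pairing θ hconv hθ hdense hy₀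
      ((measurable_coe_nnreal_real.comp φ.measurable).sub_const η)
      ((hφint φ).sub (integrable_const η)) hlt (half_pos hε)
    have hval : ∫ t, ((φ t : ℝ) - η) ∂μ = ∫ t, (φ t : ℝ) ∂μ - μ.real univ * η := by
      rw [integral_sub (hφint φ) (integrable_const η), integral_const, smul_eq_mul]
    have hyc : pairing y θ < c :=
      EReal.coe_lt_coe_iff.1 ((le_supportFun (B := pairing) hy θ).trans_lt hc₁)
    have : pairing y₀ θ + ∫ t, ((φ t : ℝ) - η) ∂μ - ε / 2 < pairing y θ := hyφ
    rw [hval] at this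
    linarith
  have hP : 0 ≤ supportFun pairing (continuousSelections S) θ - (pairing y₀ θ : EReal) :=
    (EReal.sub_nonneg (.inr (EReal.coe_ne_top _)) (.inr (EReal.coe_ne_bot _))).2
      (le_supportFun (B := pairing) hy₀ θ)
  have hF : ∫⁻ t, F t ∂μ ≤
      (supportFun pairing (continuousSelections S) θ - (pairing y₀ θ : EReal)).toENNReal := by
    -- Finite-valued simple minorants suffice, even where the gap is infinite.
    rw [lintegral_eq_nnreal]
    refine iSup₂_le fun φ hφ => ?_
    have h₁ : (φ.map ((↑) : NNReal → ENNReal)).lintegral μ = ENNReal.ofReal (∫ t, (φ t : ℝ) ∂μ) := by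
      rw [ofReal_integral_eq_lintegral_ofReal (hφint φ) (Eventually.of_forall fun t => (φ t).2),
        ← SimpleFunc.lintegral_eq_lintegral]
      simp
    rw [h₁]
    refine ENNReal.ofReal_le_toENNReal ((EReal.le_sub_iff_add_le (.inl (EReal.coe_ne_bot _))
      (.inl (EReal.coe_ne_top _))).2 ?_)
    exact_mod_cast key φ hφ
  have := EReal.coe_ennreal_le_coe_ennreal_iff.2 hF
  rwa [EReal.coe_toENNReal hP, EReal.le_sub_iff_add_le (.inl (EReal.coe_ne_bot _))
    (.inl (EReal.coe_ne_top _))] at this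

end Representation

theorem theorem2p1 {T : Type*} [TopologicalSpace T] [T2Space T] [LocallyCompactSpace T]
    [SigmaCompactSpace T] [MeasurableSpace T] [BorelSpace T] {d : ℕ}
    (S : T → Set (EuclideanSpace ℝ (Fin d))) (hconv : ∀ t, Convex ℝ (S t))
    (hne : (continuousSelections S).Nonempty) :
    -- the representation forces inner semicontinuity
    (HasIntegralRepresentation S → InnerSemicontinuous S) ∧
    -- and is equivalent to it if `T` is perfectly normal or `S` is closed-valued
    ((PerfectlyNormalSpace T ∨ ∀ t, IsClosed (S t)) →
      (HasIntegralRepresentation S ↔ InnerSemicontinuous S)) ∧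
    -- under inner semicontinuity the integrals are well defined in `(-∞, ∞]`
    (InnerSemicontinuous S → ∀ θ ∈ regularVectorMeasures T d,
      AEMeasurable (supportIntegrand S θ) θ.variation ∧
        ∫⁻ t, (-supportIntegrand S θ t).toENNReal ∂θ.variation ≠ ⊤) ∧
    -- the normals to `C(S)` if the representation holds
    (HasIntegralRepresentation S → ∀ θ ∈ regularVectorMeasures T d,
      ∀ y ∈ continuousSelections S,
        (θ ∈ normals pairing (continuousSelections S) y ↔
          ∀ᵐ t ∂θ.variation, polarDensity θ t ∈ normals dot (S t) (y t))) := by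
  refine ⟨fun hR => hR.innerSemicontinuous hconv, fun h => ⟨fun hR => hR.innerSemicontinuous hconv,
    fun hS => hS.hasIntegralRepresentation hconv hne fun t x hx ε hε =>
      hS.exists_continuousSelections_near hconv hne h hx hε⟩, fun hS θ hθ => ?_,
    fun hR θ hθ y hy => hR.mem_normals_iff θ hconv hθ hy⟩
  obtain ⟨y, hy⟩ := hne
  exact ⟨(hS.measurable_supportIntegrand θ).aemeasurable,
    lintegral_neg_toENNReal_ne_top (integrable_dot_continuous θ y)
      (Filter.Eventually.of_forall (dot_le_supportIntegrand θ hy))⟩
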